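/- **Theorem (Lorentz normal forms for qubit channels).** A qubit channel is a completely positive trace-preserving linear map $\mathcal E$ on $\mathcal B(\mathbb C^2)$. The Kraus rank of a linear map $\mathcal T$ on $\mathcal B(\mathbb C^2)$ is the least $n$ such that $\mathcal T(X)=\sum_{j=1}^n K_jXK_j^\dagger$ for some $K_1,\dots,K_n$ (no condition on the trace). The matrix of $\mathcal T$ in the Pauli basis is $\hat{\mathcal T}_{ij}=\tfrac12\operatorname{tr}(\sigma_i\mathcal T(\sigma_j))$, $0\le i,j\le 3$, $\sigma_0=\mathbb 1$. For real $v,x,z$ let $f(v,z)=\sqrt{1+v-z-vz}$ and let $\mathcal M(v,x,z)$ be the linear map with $$\hat{\mathcal M}(v,x,z)=\begin{pmatrix}1&0&0&z\\0&x f(v,z)&0&0\\0&0&x f(v,z)&0\\v&0&0&v-z+1\end{pmatrix}.$$ For every qubit channel $\mathcal E$ there are linear maps $\mathcal T_1,\mathcal T_2$ of Kraus rank one (not necessarily trace non-increasing) such that $\mathcal E=\mathcal T_2\,\mathcal M\,\mathcal T_1$, where either $\mathcal M$ is a Pauli channel, i.e. a channel with diagonal $\hat{\mathcal M}$, or $\hat{\mathcal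 M}$ is non-diagonal and $\mathcal M=\mathcal M(v,x,z)$ with $(v,x,z)$ in one of the following cases: i) $z\in[0,1)$, $v\in(-1,z]$, $x\in(-1,1)$; then $\mathcal M(v,x,z)$ has Kraus rank $3$ if $v<z$ and $2$ if $v=z$. ii) $z\in[0,1)$, $v\in(-1,z]$, $x\in\{-1,1\}$; then the Kraus rank is $2$ if $v<z$ and $1$ if $v=z$. iii) $z\in[0,1)$, $v=-1$, $x=0$; then the Kraus rank is $2$. (More generally, $\mathcal M(-1,0,z)$ has Kraus rank $2$ for $z\in(-1,1)$ and Kraus rank $1$ for $z=-1$.) iv) $z=1$, $x=0$, $v\in[-1,1]$; then the Kraus rank is $2$ if $|v|<1$ and $1$ if $|v|=1$. These statements on the Kraus rank hold for all parameters in the respective case. For $z\ge 0$, the map $\mathcal M(v,x,z)$ is completely positive if and only if it equals $\mathcal M(v,y,z)$ for some $y$ such that $(v,y,z)$ is in one of the cases i)–iv). Whenever $\mathcal M(v,x,z)$ is completely positive its Kraus rank is at most $3$, and whenever $\mathcal M(v,1,z)$ is completely positive its Kraus rank is at most $2$. -/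

import Mathlib

noncomputable section

namespace QubitLorentz

open scoped ComplexOrder

/-- Operators on a `d`-dimensional Hilbert space, as complex `d × d` matrices. -/
abbrev Op (d : ℕ) : Type := Matrix (Fin d) (Fin d) ℂ

/-- Linear maps on operators. -/
abbrev OpMap (d : ℕ) : Type := Op d →ₗ[ℂ] Op d

/-- The map `id_k ⊗ E` on operators of `ℂ^k ⊗ ℂ^d`: `E` is applied to every `d × d` block. -/
def ampliation {d : ℕ} (k : ℕ) (E : OpMap d)
    (A : Matrix (Fin k × Fin d) (Fin k × Fin d) ℂ) :
    Matrix (Fin k × Fin d) (Fin k × Fin d) ℂ :=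
  Matrix.of fun p q => E (Matrix.of fun a b => A (p.1, a) (q.1, b)) p.2 q.2

/-- Complete positivity: `id_k ⊗ E` preserves positive semidefiniteness for all `k`. -/
def IsCompletelyPositive {d : ℕ} (E : OpMap d) : Prop :=
  ∀ (k : ℕ) (A : Matrix (Fin k × Fin d) (Fin k × Fin d) ℂ),
    A.PosSemidef → (ampliation k E A).PosSemidef

/-- Quantum channels: completely positive trace-preserving linear maps. -/
def IsChannel {d : ℕ} (E : OpMap d) : Prop :=
  IsCompletelyPositive E ∧ ∀ X : Op d, (E X).trace = X.trace

/-- `E` has an operator-sum representation `X ↦ ∑ j, K j * X * (K j)ᴴ` with `n` operators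
(no trace condition). -/
def HasKrausRepresentation {d : ℕ} (E : OpMap d) (n : ℕ) : Prop :=
  ∃ K : Fin n → Op d, ∀ X : Op d, E X = ∑ j, K j * X * (K j).conjTranspose

/-- `E` has Kraus rank `n`: `n` is the least number of operators in an operator-sum
representation of `E`. In particular `E` has such a representation. -/
def HasKrausRank {d : ℕ} (E : OpMap d) (n : ℕ) : Prop :=
  IsLeast {m : ℕ | HasKrausRepresentation E m} n

/-- The Pauli matrices `σ₀ = 1, σ₁, σ₂, σ₃`. -/
def pauli : Fin 4 → Op 2 :=
  ![!![1, 0; 0, 1], !![0, 1; 1, 0], !![0, -Complex.I; Complex.I, 0], !![1, 0; 0, -1]]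

/-- The matrix of `E` in the (normalized) Pauli basis: entries `½ tr (σᵢ E(σⱼ))`. -/
def pauliMatrix (E : OpMap 2) : Matrix (Fin 4) (Fin 4) ℂ :=
  Matrix.of fun i j => (1 / 2 : ℂ) * (pauli i * E (pauli j)).trace

/-- The linear map whose matrix in the Pauli basis is `A`:
`X ↦ ½ ∑ i j, A i j * tr (σⱼ X) • σᵢ`. -/
def ofPauliMatrix (A : Matrix (Fin 4) (Fin 4) ℂ) : OpMap 2 where
  toFun X := ∑ i, ∑ j, ((1 / 2 : ℂ) * A i j * (pauli j * X).trace) • pauli i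
  map_add' X Y := by
    simp only [Matrix.trace_add, mul_add, add_smul, Finset.sum_add_distrib]
  map_smul' c X := by
    simp only [Matrix.mul_smul, Matrix.trace_smul, smul_eq_mul, RingHom.id_apply,
      Finset.smul_sum, smul_smul]
    refine Finset.sum_congr rfl fun i _ => Finset.sum_congr rfl fun j _ => ?_
    congr 1
    ring

theorem trace_pauli_mul (i j : Fin 4) :
    (pauli i * pauli j).trace = if i = j then 2 else 0 := by
  fin_cases i <;> fin_cases j <;>
    simp [pauli, Matrix.trace_fin_two] <;> norm_num

theorem pauliMatrix_ofPauliMatrix (A : Matrix (Fin 4) (Fin 4) ℂ) :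
    pauliMatrix (ofPauliMatrix A) = A := by
  ext i j
  simp [pauliMatrix, ofPauliMatrix, Matrix.mul_sum, Matrix.trace_sum, trace_pauli_mul]
  ring

/-- A Pauli channel: a qubit channel that is diagonal in the Pauli basis. -/
def IsPauliChannel (M : OpMap 2) : Prop :=
  IsChannel M ∧ (pauliMatrix M).IsDiag

/-- `f(v,z) = √(1 + v - z - v z)`. -/
def f (v z : ℝ) : ℝ := Real.sqrt (1 + v - z - v * z)

/-- The real `4 × 4` matrix of the normal form with parameters `v, x, z`. -/
def normalFormMatrix (v x z : ℝ) : Matrix (Fin 4) (Fin 4) ℝ :=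
  !![1, 0, 0, z;
     0, x * f v z, 0, 0;
     0, 0, x * f v z, 0;
     v, 0, 0, v - z + 1]

/-- The linear map `M(v,x,z)` with matrix `normalFormMatrix v x z` in the Pauli basis. -/
def normalForm (v x z : ℝ) : OpMap 2 :=
  ofPauliMatrix ((normalFormMatrix v x z).map Complex.ofReal)

def CaseI (v x z : ℝ) : Prop :=
  z ∈ Set.Ico (0 : ℝ) 1 ∧ v ∈ Set.Ioc (-1 : ℝ) z ∧ x ∈ Set.Ioo (-1 : ℝ) 1

def CaseII (v x z : ℝ) : Prop :=
  z ∈ Set.Ico (0 : ℝ) 1 ∧ v ∈ Set.Ioc (-1 : ℝ) z ∧ x ∈ ({-1, 1} : Set ℝ)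

def CaseIII (v x z : ℝ) : Prop :=
  z ∈ Set.Ico (0 : ℝ) 1 ∧ v = -1 ∧ x = 0

def CaseIV (v x z : ℝ) : Prop :=
  z = 1 ∧ x = 0 ∧ v ∈ Set.Icc (-1 : ℝ) 1

/-- The admissible parameter triples. -/
def Admissible (v x z : ℝ) : Prop :=
  CaseI v x z ∨ CaseII v x z ∨ CaseIII v x z ∨ CaseIV v x z

end QubitLorentz

end

noncomputable section

namespace QubitLorentz

open scoped ComplexOrder ComplexConjugate
open Matrix

/-! Everything is read off the Choi matrix, which is positive semidefinite for a completely positive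
map and whose rank bounds the number of Kraus operators from below. For the normal form it has
diagonal `1 + v, z - v, 0, 1 - z` and a single conjugate pair of off-diagonal entries `x * f v z`.
Its diagonal entries and one 2×2 minor settle complete positivity, and explicit factorisations give
Kraus operators in matching number.

Existence rests on a dichotomy. If `E (A * Aᴴ)` is invertible for all `A ≠ 0`, the ratio of `|det
A|²` to `det E (A * Aᴴ)` attains its maximum at an invertible `A₀`. Rescaling by `A₀` on the input
and making the output the identity gives a unital map, and first-order optimality at the identity
makes it trace preserving (`IsCompletelyPositive.isChannel_of_det_le`). A unital channel is then
brought to Pauli-diagonal form by unitaries, as in a singular value decomposition: a maximal overlap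
removes off-diagonal entries, and phases make the remaining coefficients real.

Otherwise some pure state has a singular image. Unitaries arrange that a pure basis state is fixed,
positivity of the Choi matrix leaves parameters `q, a, b`, and triangular conjugations remove `b`,
make `a` nonnegative and rescale to the normal form with `z = 1/2` (`IsChannel.exists_normalForm`).
-/

/-! ### Conjugation maps, Choi matrices and Kraus rank -/

/-- The map `X ↦ K * X * Kᴴ`. -/
def conjMap {d : ℕ} (K : Op d) : OpMap d where
  toFun X := K * X * Kᴴ
  map_add' X Y := by simp [mul_add, add_mul]
  map_smul' c X := by simp

theorem conjMap_apply {d : ℕ} (K X : Op d) : conjMap K X = K * X * Kᴴ := rfl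

theorem conjMap_comp {d : ℕ} (K L : Op d) : conjMap K ∘ₗ conjMap L = conjMap (K * L) := by
  ext1 X
  simp [conjMap_apply, Matrix.mul_assoc]

theorem conjMap_one {d : ℕ} : conjMap (1 : Op d) = LinearMap.id := by
  ext1 X
  simp [conjMap_apply]

theorem mul_mul_conjTranspose_fin_two (K X : Op 2) (i j : Fin 2) :
    (K * X * Kᴴ) i j = K i 0 * X 0 0 * star (K j 0) + K i 0 * X 0 1 * star (K j 1) +
      K i 1 * X 1 0 * star (K j 0) + K i 1 * X 1 1 * star (K j 1) := by
  simp only [Matrix.mul_apply, Fin.sum_univ_two, Matrix.conjTranspose_apply]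
  ring

theorem ampliation_conjMap {d k : ℕ} (K : Op d) (A : Matrix (Fin k × Fin d) (Fin k × Fin d) ℂ) :
    ampliation k (conjMap K) A =
      Matrix.kroneckerMap (· * ·) (1 : Op k) K * A *
        (Matrix.kroneckerMap (· * ·) (1 : Op k) K)ᴴ := by
  ext ⟨p, a⟩ ⟨q, b⟩
  simp [ampliation, conjMap_apply, Matrix.mul_apply, Fintype.sum_prod_type, Matrix.one_apply,
    apply_ite]

theorem isCompletelyPositive_conjMap {d : ℕ} (K : Op d) : IsCompletelyPositive (conjMap K) := by
  intro k A hA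
  rw [ampliation_conjMap]
  exact hA.mul_mul_conjTranspose_same _

theorem IsCompletelyPositive.comp {d : ℕ} {E F : OpMap d} (hE : IsCompletelyPositive E)
    (hF : IsCompletelyPositive F) : IsCompletelyPositive (E ∘ₗ F) :=
  fun k A hA => hE k _ (hF k A hA)

theorem HasKrausRepresentation.isCompletelyPositive {d n : ℕ} {E : OpMap d}
    (h : HasKrausRepresentation E n) : IsCompletelyPositive E := by
  obtain ⟨K, hK⟩ := h
  intro k A hA
  have : ampliation k E A = ∑ j, ampliation k (conjMap (K j)) A := by
    ext p q
    simp [ampliation, hK, conjMap_apply, Matrix.sum_apply]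
  rw [this]
  exact Matrix.posSemidef_sum _ fun j _ => isCompletelyPositive_conjMap (K j) k A hA

theorem IsCompletelyPositive.map_posSemidef {d : ℕ} {E : OpMap d} (hE : IsCompletelyPositive E)
    {X : Op d} (hX : X.PosSemidef) : (E X).PosSemidef :=
  (hE 1 _ (hX.submatrix Prod.snd)).submatrix fun a => ((0 : Fin 1), a)

/-- The Choi matrix of `E`. -/
def choi {d : ℕ} (E : OpMap d) : Matrix (Fin d × Fin d) (Fin d × Fin d) ℂ :=
  Matrix.of fun p q => E (Matrix.single p.1 q.1 1) p.2 q.2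

theorem choi_apply {d : ℕ} (E : OpMap d) (i k j l : Fin d) :
    choi E (i, k) (j, l) = E (Matrix.single i j 1) k l := rfl

theorem IsCompletelyPositive.posSemidef_choi {d : ℕ} {E : OpMap d}
    (hE : IsCompletelyPositive E) : (choi E).PosSemidef := by
  -- The Choi matrix is the ampliation applied to the unnormalised maximally entangled projector.
  have h := hE d _ (Matrix.posSemidef_vecMulVec_self_star
    (fun p : Fin d × Fin d => if p.1 = p.2 then (1 : ℂ) else 0))
  convert h using 1
  ext ⟨i, k⟩ ⟨j, l⟩
  have hX : Matrix.single i j (1 : ℂ) = Matrix.of fun a b =>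
      Matrix.vecMulVec (fun p : Fin d × Fin d => if p.1 = p.2 then (1 : ℂ) else 0)
        (star fun p : Fin d × Fin d => if p.1 = p.2 then (1 : ℂ) else 0) (i, a) (j, b) := by
    ext a b
    by_cases h1 : i = a <;> by_cases h2 : j = b <;>
      simp [Matrix.vecMulVec_apply, h1, h2]
  rw [choi_apply, hX]
  rfl

/-- The number of Kraus operators is at least the size of any invertible square submatrix of
the Choi matrix. -/
theorem HasKrausRepresentation.le_of_det_ne_zero {d n m : ℕ} {E : OpMap d}
    (h : HasKrausRepresentation E n) (e : Fin m → Fin d × Fin d)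
    (hdet : ((choi E).submatrix e e).det ≠ 0) : m ≤ n := by
  obtain ⟨K, hK⟩ := h
  let V : Matrix (Fin m) (Fin n) ℂ := Matrix.of fun a j => K j (e a).2 (e a).1
  have hV : (choi E).submatrix e e = V * Vᴴ := by
    ext a b
    simp [choi, hK, V, Matrix.mul_apply, Matrix.sum_apply, Matrix.single_apply, ite_and]
  have h1 : ((choi E).submatrix e e).rank = m := by
    rw [Matrix.rank_of_isUnit _ ((Matrix.isUnit_iff_isUnit_det _).2 (isUnit_iff_ne_zero.2 hdet)),
      Fintype.card_fin]
  rw [hV] at h1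
  calc m = (V * Vᴴ).rank := h1.symm
    _ ≤ V.rank := Matrix.rank_mul_le_left _ _
    _ ≤ n := Matrix.rank_le_width _

/-- The certificate for every rank computation below: a representation together with a nonzero
principal Choi minor of the same size. -/
theorem hasKrausRank_of_det_ne_zero {d n : ℕ} {E : OpMap d}
    (h : HasKrausRepresentation E n) (e : Fin n → Fin d × Fin d)
    (hdet : ((choi E).submatrix e e).det ≠ 0) : HasKrausRank E n :=
  ⟨h, fun _ hm => HasKrausRepresentation.le_of_det_ne_zero hm e hdet⟩

theorem HasKrausRepresentation.exists_hasKrausRank_le {d n : ℕ} {E : OpMap d}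
    (h : HasKrausRepresentation E n) : ∃ m ≤ n, HasKrausRank E m := by
  classical
  exact ⟨Nat.find ⟨n, h⟩, Nat.find_min' ⟨n, h⟩ h, Nat.find_spec ⟨n, h⟩,
    fun m hm => Nat.find_min' ⟨n, h⟩ hm⟩

theorem hasKrausRank_conjMap {d : ℕ} {K : Op d} (hK : K ≠ 0) : HasKrausRank (conjMap K) 1 := by
  obtain ⟨i, j, hij⟩ : ∃ i j, K i j ≠ 0 := by
    by_contra! h
    exact hK (Matrix.ext h)
  refine hasKrausRank_of_det_ne_zero ⟨fun _ => K, fun X => by simp [conjMap_apply]⟩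
    (fun _ => (j, i)) ?_
  simpa [choi, conjMap_apply, Matrix.mul_apply, Matrix.single_apply, ite_and] using hij

/-! ### Choi matrix and complete positivity of the normal form -/

theorem normalForm_apply (v x z : ℝ) (X : Op 2) :
    normalForm v x z X =
      !![(1 + v) * X 0 0, ((x * f v z : ℝ) : ℂ) * X 0 1;
         ((x * f v z : ℝ) : ℂ) * X 1 0, (z - v) * X 0 0 + (1 - z) * X 1 1] := by
  ext i j
  fin_cases i <;> fin_cases j <;>
    simp [normalForm, ofPauliMatrix, normalFormMatrix, pauli, Fin.sum_univ_four,
      Matrix.trace_fin_two, Matrix.mul_apply, Fin.sum_univ_two] <;>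
    ring_nf <;> simp [Complex.I_sq] <;> ring_nf

theorem choi_normalForm (v x z : ℝ) :
    choi (normalForm v x z) = Matrix.of fun p q : Fin 2 × Fin 2 =>
      (if p = q then (if p.1 = 0 then (if p.2 = 0 then 1 + v else z - v)
        else (if p.2 = 0 then 0 else 1 - z))
      else if p = (0, 0) ∧ q = (1, 1) ∨ p = (1, 1) ∧ q = (0, 0) then ((x * f v z : ℝ) : ℂ)
      else 0 : ℂ) := by
  ext ⟨i, k⟩ ⟨j, l⟩
  rw [choi_apply, normalForm_apply]
  fin_cases i <;> fin_cases j <;> fin_cases k <;> fin_cases l <;> simp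

theorem f_eq_sqrt_mul (v z : ℝ) : f v z = √((1 + v) * (1 - z)) := by
  rw [f]; congr 1; ring

theorem IsCompletelyPositive.normalForm_bounds {v x z : ℝ}
    (h : IsCompletelyPositive (normalForm v x z)) :
    0 ≤ 1 + v ∧ 0 ≤ z - v ∧ 0 ≤ 1 - z ∧ (x * f v z) ^ 2 ≤ (1 + v) * (1 - z) := by
  have hC := h.posSemidef_choi
  rw [choi_normalForm] at hC
  have h0 := hC.diag_nonneg (i := (0, 0))
  have h1 := hC.diag_nonneg (i := (0, 1))
  have h2 := hC.diag_nonneg (i := (1, 1))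
  have h3 := (hC.submatrix ![(0, 0), (1, 1)]).det_nonneg
  rw [Matrix.det_fin_two] at h3
  simp at h0 h1 h2 h3
  norm_cast at h0 h1 h2 h3
  refine ⟨h0, by linarith, by linarith, ?_⟩
  nlinarith

theorem ofReal_sqrt_mul_self {a : ℝ} (ha : 0 ≤ a) : ((√a : ℝ) : ℂ) * ((√a : ℝ) : ℂ) = a := by
  rw [← Complex.ofReal_mul, Real.mul_self_sqrt ha]

/-! ### Kraus operators and Kraus ranks of the normal forms -/

section Kraus

variable {v x z : ℝ}

/-- The first two operators are a Cholesky factorisation of the Choi block on `(0,0), (1,1)`; the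
third carries the isolated entry `z - v`. The second vanishes for `x ^ 2 = 1` and the third for `v =
z`, which gives the shorter representations that follow. -/
theorem hasKrausRepresentation_three (h0 : 0 ≤ 1 + v) (h1 : 0 ≤ z - v) (h2 : 0 ≤ 1 - z)
    (hx : x ^ 2 ≤ 1) : HasKrausRepresentation (normalForm v x z) 3 := by
  have e0 := ofReal_sqrt_mul_self h0
  have e1 := ofReal_sqrt_mul_self h1
  have e2 := ofReal_sqrt_mul_self h2
  have e3 := ofReal_sqrt_mul_self (sub_nonneg.2 hx)
  refine ⟨![!![(√(1 + v) : ℝ), 0; 0, (x : ℂ) * (√(1 - z) : ℝ)],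
    !![0, 0; 0, (√(1 - x ^ 2) : ℝ) * (√(1 - z) : ℝ)],
    !![0, 0; (√(z - v) : ℝ), 0]], fun X => ?_⟩
  rw [normalForm_apply, f_eq_sqrt_mul, Real.sqrt_mul h0]
  push_cast at e0 e1 e2 e3 ⊢
  ext i j
  fin_cases i <;> fin_cases j <;>
    simp only [Fin.sum_univ_three, Matrix.add_apply, mul_mul_conjTranspose_fin_two] <;>
    simp [Complex.conj_ofReal]
  · linear_combination -X 0 0 * e0
  · ring
  · ring
  · linear_combination -X 0 0 * e1 - X 1 1 * e2 - X 1 1 * ((√(1 - z) : ℝ) : ℂ) ^ 2 * e3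

theorem hasKrausRepresentation_two (h0 : 0 ≤ 1 + v) (h1 : 0 ≤ z - v) (h2 : 0 ≤ 1 - z)
    (hx : x ^ 2 = 1) : HasKrausRepresentation (normalForm v x z) 2 := by
  have e0 := ofReal_sqrt_mul_self h0
  have e1 := ofReal_sqrt_mul_self h1
  have e2 := ofReal_sqrt_mul_self h2
  have e3 : (x : ℂ) ^ 2 = 1 := by exact_mod_cast hx
  refine ⟨![!![(√(1 + v) : ℝ), 0; 0, (x : ℂ) * (√(1 - z) : ℝ)],
    !![0, 0; (√(z - v) : ℝ), 0]], fun X => ?_⟩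
  rw [normalForm_apply, f_eq_sqrt_mul, Real.sqrt_mul h0]
  push_cast at e0 e1 e2 ⊢
  ext i j
  fin_cases i <;> fin_cases j <;>
    simp only [Fin.sum_univ_two, Matrix.add_apply, mul_mul_conjTranspose_fin_two] <;>
    simp [Complex.conj_ofReal]
  · linear_combination -X 0 0 * e0
  · ring
  · ring
  · linear_combination -X 0 0 * e1 - X 1 1 * e2 - X 1 1 * ((√(1 - z) : ℝ) : ℂ) ^ 2 * e3

theorem hasKrausRepresentation_two_of_eq (h0 : 0 ≤ 1 + v) (h2 : 0 ≤ 1 - v)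
    (hx : x ^ 2 ≤ 1) : HasKrausRepresentation (normalForm v x v) 2 := by
  have e0 := ofReal_sqrt_mul_self h0
  have e2 := ofReal_sqrt_mul_self h2
  have e3 := ofReal_sqrt_mul_self (sub_nonneg.2 hx)
  refine ⟨![!![(√(1 + v) : ℝ), 0; 0, (x : ℂ) * (√(1 - v) : ℝ)],
    !![0, 0; 0, (√(1 - x ^ 2) : ℝ) * (√(1 - v) : ℝ)]], fun X => ?_⟩
  rw [normalForm_apply, f_eq_sqrt_mul, Real.sqrt_mul h0]
  push_cast at e0 e2 e3 ⊢
  ext i j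
  fin_cases i <;> fin_cases j <;>
    simp only [Fin.sum_univ_two, Matrix.add_apply, mul_mul_conjTranspose_fin_two] <;>
    simp [Complex.conj_ofReal]
  · linear_combination -X 0 0 * e0
  · ring
  · ring
  · linear_combination - X 1 1 * e2 - X 1 1 * ((√(1 - v) : ℝ) : ℂ) ^ 2 * e3

theorem hasKrausRepresentation_one_of_eq (h0 : 0 ≤ 1 + v) (h2 : 0 ≤ 1 - v)
    (hx : x ^ 2 = 1) : HasKrausRepresentation (normalForm v x v) 1 := by
  have e0 := ofReal_sqrt_mul_self h0
  have e2 := ofReal_sqrt_mul_self h2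
  have e3 : (x : ℂ) ^ 2 = 1 := by exact_mod_cast hx
  refine ⟨![!![(√(1 + v) : ℝ), 0; 0, (x : ℂ) * (√(1 - v) : ℝ)]], fun X => ?_⟩
  rw [normalForm_apply, f_eq_sqrt_mul, Real.sqrt_mul h0]
  push_cast at e0 e2 ⊢
  ext i j
  fin_cases i <;> fin_cases j <;>
    simp only [Fin.sum_univ_one, mul_mul_conjTranspose_fin_two] <;>
    simp [Complex.conj_ofReal]
  · linear_combination -X 0 0 * e0
  · ring
  · ring
  · linear_combination - X 1 1 * e2 - X 1 1 * ((√(1 - v) : ℝ) : ℂ) ^ 2 * e3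

theorem normalForm_congr {y : ℝ} (h : x * f v z = y * f v z) :
    normalForm v x z = normalForm v y z := by
  simp [normalForm, normalFormMatrix, h]

theorem f_neg_one (z : ℝ) : f (-1) z = 0 := by simp [f]

theorem f_one_right (v : ℝ) : f v 1 = 0 := by simp [f]

theorem f_pos (h0 : -1 < v) (h2 : z < 1) : 0 < f v z := by
  rw [f_eq_sqrt_mul]
  exact Real.sqrt_pos.2 (mul_pos (by linarith) (by linarith))

theorem f_sq (h0 : -1 ≤ v) (h2 : z ≤ 1) : f v z ^ 2 = (1 + v) * (1 - z) := by
  rw [f_eq_sqrt_mul]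
  exact Real.sq_sqrt (mul_nonneg (by linarith) (by linarith))

theorem hasKrausRepresentation_neg_one_one :
    HasKrausRepresentation (normalForm (-1) x 1) 1 := by
  have e1 := ofReal_sqrt_mul_self (zero_le_two (α := ℝ))
  refine ⟨![!![0, 0; (√2 : ℝ), 0]], fun X => ?_⟩
  rw [normalForm_apply, f_neg_one]
  push_cast at e1 ⊢
  ext i j
  fin_cases i <;> fin_cases j <;>
    simp only [Fin.sum_univ_one, mul_mul_conjTranspose_fin_two] <;>
    simp [Complex.conj_ofReal]
  linear_combination -X 0 0 * e1

theorem CaseI.krausRank (h : CaseI v x z) :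
    (v < z → HasKrausRank (normalForm v x z) 3) ∧
      (v = z → HasKrausRank (normalForm v x z) 2) := by
  obtain ⟨⟨hz0, hz1⟩, ⟨hv0, hv1⟩, hx0, hx1⟩ := h
  have hx : x ^ 2 < 1 := by nlinarith
  have hf := f_sq hv0.le hz1.le
  have hpos : 0 < (1 + v) * (1 - z) := mul_pos (by linarith) (by linarith)
  -- The minor of the coupled 2×2 block; it would vanish for `x = ±1`.
  have hminor : (1 + v) * (1 - z) - (x * f v z) * (x * f v z) ≠ 0 := by
    have : (1 + v) * (1 - z) - (x * f v z) * (x * f v z) = (1 - x ^ 2) * ((1 + v) * (1 - z)) := by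
      linear_combination (-x ^ 2) * hf
    rw [this]
    exact (mul_pos (by linarith) hpos).ne'
  refine ⟨fun hvz => ?_, fun hvz => ?_⟩
  · refine hasKrausRank_of_det_ne_zero (hasKrausRepresentation_three (by linarith) (by linarith)
      (by linarith) hx.le) ![(0, 0), (0, 1), (1, 1)] ?_
    rw [choi_normalForm, Matrix.det_fin_three]
    have := mul_ne_zero hminor (sub_pos.2 hvz).ne'
    have h' := Complex.ofReal_ne_zero.2 this
    push_cast at h'
    simp
    exact fun h0 => h' (by linear_combination h0)
  · subst hvz
    refine hasKrausRank_of_det_ne_zero (hasKrausRepresentation_two_of_eq (by linarith)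
      (by linarith) hx.le) ![(0, 0), (1, 1)] ?_
    rw [choi_normalForm, Matrix.det_fin_two]
    have h' := Complex.ofReal_ne_zero.2 hminor
    push_cast at h'
    simpa using h'

theorem CaseII.krausRank (h : CaseII v x z) :
    (v < z → HasKrausRank (normalForm v x z) 2) ∧
      (v = z → HasKrausRank (normalForm v x z) 1) := by
  obtain ⟨⟨hz0, hz1⟩, ⟨hv0, hv1⟩, hx⟩ := h
  have hx : x ^ 2 = 1 := by rcases hx with rfl | rfl <;> norm_num
  refine ⟨fun hvz => ?_, fun hvz => ?_⟩
  · refine hasKrausRank_of_det_ne_zero (hasKrausRepresentation_two (by linarith) (by linarith)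
      (by linarith) hx) ![(0, 0), (0, 1)] ?_
    rw [choi_normalForm, Matrix.det_fin_two]
    have h' := Complex.ofReal_ne_zero.2 (mul_pos (neg_lt_iff_pos_add'.1 hv0) (sub_pos.2 hvz)).ne'
    push_cast at h'
    simpa using h'
  · subst hvz
    refine hasKrausRank_of_det_ne_zero (hasKrausRepresentation_one_of_eq (by linarith)
      (by linarith) hx) ![(0, 0)] ?_
    rw [choi_normalForm, Matrix.det_fin_one]
    have h' := Complex.ofReal_ne_zero.2 (neg_lt_iff_pos_add'.1 hv0).ne'
    push_cast at h'
    simpa using h'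

theorem krausRank_normalForm_neg_one (hz : z ∈ Set.Ico (-1 : ℝ) 1) :
    (-1 < z → HasKrausRank (normalForm (-1) 0 z) 2) ∧
      (z = -1 → HasKrausRank (normalForm (-1) 0 z) 1) := by
  obtain ⟨hz0, hz1⟩ := hz
  -- Since `f` vanishes, `x` is immaterial; `x = 1` gives access to the shorter representations.
  rw [normalForm_congr (y := 1) (by rw [f_neg_one, mul_zero, mul_zero])]
  refine ⟨fun hvz => ?_, fun hvz => ?_⟩
  · refine hasKrausRank_of_det_ne_zero (hasKrausRepresentation_two (by norm_num) (by linarith)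
      (by linarith) (one_pow 2)) ![(0, 1), (1, 1)] ?_
    rw [choi_normalForm, Matrix.det_fin_two]
    have h' := Complex.ofReal_ne_zero.2 (mul_pos (sub_pos.2 hvz) (sub_pos.2 hz1)).ne'
    push_cast at h'
    simpa using h'
  · subst hvz
    refine hasKrausRank_of_det_ne_zero (hasKrausRepresentation_one_of_eq (by norm_num)
      (by norm_num) (one_pow 2)) ![(1, 1)] ?_
    rw [choi_normalForm, Matrix.det_fin_one]
    norm_num

theorem CaseIV.krausRank (h : CaseIV v x z) :
    (|v| < 1 → HasKrausRank (normalForm v x z) 2) ∧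
      (|v| = 1 → HasKrausRank (normalForm v x z) 1) := by
  obtain ⟨rfl, rfl, hv0, hv1⟩ := h
  rw [normalForm_congr (y := 1) (by rw [f_one_right, mul_zero, mul_zero])]
  refine ⟨fun hv => ?_, fun hv => ?_⟩
  · obtain ⟨h1, h2⟩ := abs_lt.1 hv
    refine hasKrausRank_of_det_ne_zero (hasKrausRepresentation_two (by linarith) (by linarith)
      (by linarith) (one_pow 2)) ![(0, 0), (0, 1)] ?_
    rw [choi_normalForm, Matrix.det_fin_two]
    have h' := Complex.ofReal_ne_zero.2 (mul_pos (neg_lt_iff_pos_add'.1 h1) (sub_pos.2 h2)).ne'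
    push_cast at h'
    simpa using h'
  · rcases (abs_eq zero_le_one).1 hv with rfl | rfl
    · refine hasKrausRank_of_det_ne_zero (hasKrausRepresentation_one_of_eq (by norm_num)
        (by norm_num) (one_pow 2)) ![(0, 0)] ?_
      rw [choi_normalForm, Matrix.det_fin_one]
      norm_num
    · refine hasKrausRank_of_det_ne_zero hasKrausRepresentation_neg_one_one ![(0, 1)] ?_
      rw [choi_normalForm, Matrix.det_fin_one]
      norm_num

/-- If `M(v,x,z)` is completely positive, the parameter `x` may be replaced by one in `[-1,1]`,
and by `0` if `f(v,z)` vanishes. -/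
theorem IsCompletelyPositive.sq_le_one_or (h : IsCompletelyPositive (normalForm v x z)) :
    (-1 < v ∧ z < 1 ∧ x ^ 2 ≤ 1) ∨ f v z = 0 := by
  obtain ⟨h0, h1, h2, h3⟩ := h.normalForm_bounds
  have hf := f_sq (by linarith : -1 ≤ v) (by linarith : z ≤ 1)
  rcases h0.eq_or_lt with h0 | h0
  · exact Or.inr (pow_eq_zero_iff two_ne_zero |>.1 (by rw [hf, ← h0, zero_mul]))
  rcases h2.eq_or_lt with h2 | h2
  · exact Or.inr (pow_eq_zero_iff two_ne_zero |>.1 (by rw [hf, ← h2, mul_zero]))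
  refine Or.inl ⟨by linarith, by linarith, ?_⟩
  have hp := mul_pos h0 h2
  rw [mul_pow, hf] at h3
  exact le_of_mul_le_mul_right (by linarith) hp

theorem IsCompletelyPositive.hasKrausRepresentation_three
    (h : IsCompletelyPositive (normalForm v x z)) :
    HasKrausRepresentation (normalForm v x z) 3 := by
  obtain ⟨h0, h1, h2, -⟩ := h.normalForm_bounds
  rcases h.sq_le_one_or with ⟨-, -, hx⟩ | hf
  · exact QubitLorentz.hasKrausRepresentation_three h0 h1 h2 hx
  · rw [normalForm_congr (y := 0) (by rw [hf, mul_zero, mul_zero])]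
    exact QubitLorentz.hasKrausRepresentation_three h0 h1 h2 (by norm_num)

theorem Admissible.isCompletelyPositive (h : Admissible v x z) :
    IsCompletelyPositive (normalForm v x z) := by
  rcases h with ⟨⟨hz0, hz1⟩, ⟨hv0, hv1⟩, hx0, hx1⟩ | ⟨⟨hz0, hz1⟩, ⟨hv0, hv1⟩, hx⟩ |
    ⟨⟨hz0, hz1⟩, rfl, rfl⟩ | ⟨rfl, rfl, hv0, hv1⟩
  · exact (hasKrausRepresentation_three (by linarith) (by linarith) (by linarith)
      (by nlinarith)).isCompletelyPositive
  · exact (hasKrausRepresentation_three (by linarith) (by linarith) (by linarith)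
      (by rcases hx with rfl | rfl <;> norm_num)).isCompletelyPositive
  · exact (hasKrausRepresentation_three (by linarith) (by linarith) (by linarith)
      (by norm_num)).isCompletelyPositive
  · exact (hasKrausRepresentation_three (by linarith) (by linarith) (by linarith)
      (by norm_num)).isCompletelyPositive

/-- If `f v z ≠ 0`, the minor bound puts `x` in `[-1,1]`, which is case I or II. If `f v z = 0`, the
value of `x` plays no role and is reset to `0`; then `z < 1` forces `v = -1`, and `z = 1` is case
IV. -/
theorem IsCompletelyPositive.exists_admissible (h : IsCompletelyPositive (normalForm v x z))
    (hz : 0 ≤ z) : ∃ y, Admissible v y z ∧ normalForm v x z = normalForm v y z := by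
  obtain ⟨h0, h1, h2, -⟩ := h.normalForm_bounds
  rcases h.sq_le_one_or with ⟨hv, hz1, hx⟩ | hf
  · refine ⟨x, ?_, rfl⟩
    rcases hx.lt_or_eq with hx | hx
    · exact Or.inl ⟨⟨hz, hz1⟩, ⟨hv, by linarith⟩, by nlinarith, by nlinarith⟩
    · exact Or.inr (Or.inl ⟨⟨hz, hz1⟩, ⟨hv, by linarith⟩, by
        rcases (sq_eq_sq_iff_eq_or_eq_neg.1 (hx.trans (one_pow 2).symm)) with h | h <;> simp [h]⟩)
  · refine ⟨0, ?_, normalForm_congr (by rw [hf, mul_zero, mul_zero])⟩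
    have hf' := f_sq (by linarith : -1 ≤ v) (by linarith : z ≤ 1)
    rcases (by linarith : z ≤ 1).lt_or_eq with hz1 | hz1
    · refine Or.inr (Or.inr (Or.inl ⟨⟨hz, hz1⟩, ?_, rfl⟩))
      by_contra hv
      have : -1 < v := lt_of_le_of_ne (by linarith) (Ne.symm hv)
      exact (f_pos this hz1).ne' hf
    · exact Or.inr (Or.inr (Or.inr ⟨hz1, rfl, by linarith, by linarith⟩))

end Kraus

/-! ### Local equivalence -/

/-- `M` arises from `E` by composition with invertible maps of Kraus rank one on both sides. -/
def LocallyEquivalent (E M : OpMap 2) : Prop :=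
  ∃ A B : Op 2, IsUnit A.det ∧ IsUnit B.det ∧ M = conjMap B ∘ₗ E ∘ₗ conjMap A

theorem LocallyEquivalent.trans {E F G : OpMap 2} (h : LocallyEquivalent E F)
    (h' : LocallyEquivalent F G) : LocallyEquivalent E G := by
  obtain ⟨A, B, hA, hB, rfl⟩ := h
  obtain ⟨A', B', hA', hB', rfl⟩ := h'
  refine ⟨A * A', B' * B, by rw [det_mul]; exact hA.mul hA', by rw [det_mul]; exact hB'.mul hB, ?_⟩
  rw [← conjMap_comp, ← conjMap_comp]
  rfl

theorem LocallyEquivalent.symm {E F : OpMap 2} (h : LocallyEquivalent E F) :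
    LocallyEquivalent F E := by
  obtain ⟨A, B, hA, hB, rfl⟩ := h
  refine ⟨A⁻¹, B⁻¹, isUnit_nonsing_inv_det A hA, isUnit_nonsing_inv_det B hB, ?_⟩
  have h1 : conjMap B⁻¹ ∘ₗ conjMap B = LinearMap.id := by
    rw [conjMap_comp, nonsing_inv_mul B hB, conjMap_one]
  have h2 : conjMap A ∘ₗ conjMap A⁻¹ = LinearMap.id := by
    rw [conjMap_comp, mul_nonsing_inv A hA, conjMap_one]
  calc E = (conjMap B⁻¹ ∘ₗ conjMap B) ∘ₗ E ∘ₗ (conjMap A ∘ₗ conjMap A⁻¹) := by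
        rw [h1, h2]; rfl
    _ = _ := rfl

theorem LocallyEquivalent.isCompletelyPositive {E F : OpMap 2} (h : LocallyEquivalent E F)
    (hE : IsCompletelyPositive E) : IsCompletelyPositive F := by
  obtain ⟨A, B, -, -, rfl⟩ := h
  exact (isCompletelyPositive_conjMap B).comp (hE.comp (isCompletelyPositive_conjMap A))

theorem LocallyEquivalent.exists_eq_comp {E F : OpMap 2} (h : LocallyEquivalent E F) :
    ∃ T₁ T₂ : OpMap 2, HasKrausRank T₁ 1 ∧ HasKrausRank T₂ 1 ∧ E = T₂ ∘ₗ F ∘ₗ T₁ := by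
  obtain ⟨A, B, hA, hB, h⟩ := h.symm
  refine ⟨conjMap A, conjMap B, hasKrausRank_conjMap ?_, hasKrausRank_conjMap ?_, h⟩
  · rintro rfl
    simp at hA
  · rintro rfl
    simp at hB

/-- Conjugation of a channel by unitaries on both sides gives a channel. -/
theorem IsChannel.unitary_comp {E : OpMap 2} (hE : IsChannel E) {U V : Op 2}
    (hU : Uᴴ * U = 1) (hV : Vᴴ * V = 1) :
    LocallyEquivalent E (conjMap U ∘ₗ E ∘ₗ conjMap V) ∧
      IsChannel (conjMap U ∘ₗ E ∘ₗ conjMap V) := by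
  refine ⟨⟨V, U, ?_, ?_, rfl⟩, (isCompletelyPositive_conjMap U).comp
    (hE.1.comp (isCompletelyPositive_conjMap V)), fun X => ?_⟩
  · exact isUnit_det_of_left_inverse hV
  · exact isUnit_det_of_left_inverse hU
  · simp only [LinearMap.comp_apply, conjMap_apply]
    rw [trace_mul_comm, ← Matrix.mul_assoc, hU, Matrix.one_mul, hE.2, trace_mul_comm,
      ← Matrix.mul_assoc, hV, Matrix.one_mul]

/-! ### Channels with a singular output: the non-diagonal normal form -/

/-- Any nonzero vector is proportional to the first column of some unitary. -/
theorem exists_unitary_first_column (w : Fin 2 → ℂ) (hw : w ≠ 0) :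
    ∃ U : Op 2, Uᴴ * U = 1 ∧ U * Uᴴ = 1 ∧ ∃ c : ℂ, ∀ i, U i 0 = c * w i := by
  have hpos : 0 < Complex.normSq (w 0) + Complex.normSq (w 1) := by
    by_contra h
    apply hw
    have h0 := Complex.normSq_nonneg (w 0)
    have h1 := Complex.normSq_nonneg (w 1)
    have h2 : Complex.normSq (w 0) = 0 := by linarith
    have h3 : Complex.normSq (w 1) = 0 := by linarith
    ext i
    fin_cases i
    · exact Complex.normSq_eq_zero.1 h2
    · exact Complex.normSq_eq_zero.1 h3
  set N := Complex.normSq (w 0) + Complex.normSq (w 1) with hN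
  have hc : ((√N : ℝ) : ℂ)⁻¹ * ((√N : ℝ) : ℂ)⁻¹ * (N : ℂ) = 1 := by
    rw [← mul_inv, ofReal_sqrt_mul_self hpos.le]
    exact inv_mul_cancel₀ (Complex.ofReal_ne_zero.2 hpos.ne')
  have hNc : (N : ℂ) = w 0 * conj (w 0) + w 1 * conj (w 1) := by
    rw [hN, Complex.mul_conj, Complex.mul_conj, Complex.ofReal_add]
  rw [hNc] at hc
  have hU : (!![((√N : ℝ) : ℂ)⁻¹ * w 0, -(((√N : ℝ) : ℂ)⁻¹ * conj (w 1));
      ((√N : ℝ) : ℂ)⁻¹ * w 1, ((√N : ℝ) : ℂ)⁻¹ * conj (w 0)] : Op 2)ᴴ *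
      !![((√N : ℝ) : ℂ)⁻¹ * w 0, -(((√N : ℝ) : ℂ)⁻¹ * conj (w 1));
      ((√N : ℝ) : ℂ)⁻¹ * w 1, ((√N : ℝ) : ℂ)⁻¹ * conj (w 0)] = 1 := by
    ext i j
    fin_cases i <;> fin_cases j <;>
      simp [Matrix.mul_apply, Fin.sum_univ_two, Complex.conj_ofReal]
    · linear_combination hc
    · ring
    · ring
    · linear_combination hc
  refine ⟨_, hU, mul_eq_one_comm.1 hU, ((√N : ℝ) : ℂ)⁻¹, fun i => ?_⟩
  fin_cases i <;> simp

theorem exists_unitary_second_column (w : Fin 2 → ℂ) (hw : w ≠ 0) :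
    ∃ U : Op 2, Uᴴ * U = 1 ∧ U * Uᴴ = 1 ∧ ∃ c : ℂ, ∀ i, U i 1 = c * w i := by
  obtain ⟨U, h1, -, c, hc⟩ := exists_unitary_first_column w hw
  have hS : (!![0, 1; 1, 0] : Op 2)ᴴ * !![0, 1; 1, 0] = 1 := by
    ext i j
    fin_cases i <;> fin_cases j <;> simp [Matrix.mul_apply, Fin.sum_univ_two]
  have hU : (U * !![0, 1; 1, 0])ᴴ * (U * !![0, 1; 1, 0]) = 1 := by
    rw [conjTranspose_mul, Matrix.mul_assoc, ← Matrix.mul_assoc Uᴴ, h1, Matrix.one_mul, hS]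
  refine ⟨_, hU, mul_eq_one_comm.1 hU, c, fun i => ?_⟩
  simp [Matrix.mul_apply, Fin.sum_univ_two, hc]

/-- The principal minor on `i, j` equals `-|C i j|²` and is nonnegative. -/
theorem PosSemidef.apply_eq_zero {n : Type*} {C : Matrix n n ℂ} (hC : C.PosSemidef) {i : n}
    (hi : C i i = 0) (j : n) : C i j = 0 := by
  have h := (hC.submatrix ![i, j]).det_nonneg
  rw [det_fin_two] at h
  simp only [submatrix_apply, cons_val_zero, cons_val_one, hi, zero_mul, zero_sub] at h
  rw [← hC.isHermitian.apply j i, Complex.star_def, Complex.mul_conj] at h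
  norm_cast at h
  exact Complex.normSq_eq_zero.1 (le_antisymm (by linarith) (Complex.normSq_nonneg _))

theorem map_eq_sum_single (E : OpMap 2) (X : Op 2) :
    E X = X 0 0 • E (single 0 0 1) + X 0 1 • E (single 0 1 1) + X 1 0 • E (single 1 0 1) +
      X 1 1 • E (single 1 1 1) := by
  simp only [← map_smul, ← map_add]
  congr 1
  ext i j
  fin_cases i <;> fin_cases j <;> simp

theorem IsCompletelyPositive.map_single_apply_conj {E : OpMap 2} (hE : IsCompletelyPositive E)
    (i j k l : Fin 2) : conj (E (single i j 1) k l) = E (single j i 1) l k :=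
  hE.posSemidef_choi.isHermitian.apply (j, l) (i, k)

/-- A completely positive map that does not have full rank at some nonzero `A * Aᴴ` maps some pure
state to a singular matrix. -/
theorem IsChannel.exists_locallyEquivalent_apply_eq_zero {E : OpMap 2} (hE : IsChannel E)
    {A : Op 2} (hA : A ≠ 0) (hdet : (E (A * Aᴴ)).det = 0) :
    ∃ F, LocallyEquivalent E F ∧ IsChannel F ∧ F (single 1 1 1) 0 0 = 0 := by
  obtain ⟨w, hw, hEw⟩ := exists_mulVec_eq_zero_iff.2 hdet
  obtain ⟨j, hj⟩ : ∃ j, A.col j ≠ 0 := by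
    by_contra! h
    exact hA (Matrix.ext fun i j => congr_fun (h j) i)
  obtain ⟨U, hU, hU', c, hc⟩ := exists_unitary_first_column w hw
  obtain ⟨V, hV, -, d, hd⟩ := exists_unitary_second_column _ hj
  obtain ⟨h1, h2⟩ := hE.unitary_comp (U := Uᴴ) (by rwa [conjTranspose_conjTranspose]) hV
  refine ⟨_, h1, h2, ?_⟩
  have hsum : E (A * Aᴴ) = ∑ k, E (conjMap A (single k k 1)) := by
    rw [← map_sum, ← map_sum]
    congr 1
    have : ∑ k : Fin 2, single k k (1 : ℂ) = 1 := by
      ext i j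
      fin_cases i <;> fin_cases j <;> simp [Fin.sum_univ_two]
    rw [this, conjMap_apply, Matrix.mul_one]
  have hpsd : ∀ k, (E (conjMap A (single k k 1))).PosSemidef := fun k =>
    hE.1.map_posSemidef (by
      have : (single k k (1 : ℂ)).PosSemidef := by
        simpa using posSemidef_conjTranspose_mul_self (single k k (1 : ℂ))
      exact this.mul_mul_conjTranspose_same A)
  -- `A * Aᴴ` is the sum of the rank-one matrices of its columns. Their images have nonnegative
  -- quadratic forms at `w` with sum zero, so each form vanishes there.
  have hzero : star w ⬝ᵥ (E (conjMap A (single j j 1)) *ᵥ w) = 0 := by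
    have h0 : ∑ k, star w ⬝ᵥ (E (conjMap A (single k k 1)) *ᵥ w) = 0 := by
      rw [← dotProduct_sum, ← sum_mulVec, ← hsum, hEw, dotProduct_zero]
    exact (Finset.sum_eq_zero_iff_of_nonneg
      fun k _ => (hpsd k).dotProduct_mulVec_nonneg w).1 h0 j (Finset.mem_univ j)
  have hVj : conjMap V (single 1 1 1) = (d * conj d) • conjMap A (single j j 1) := by
    ext a b
    rw [Matrix.smul_apply, conjMap_apply, conjMap_apply]
    simp only [mul_apply, conjTranspose_apply, single_apply]
    simp [ite_and, hd]
    ring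
  simp only [LinearMap.comp_apply, hVj, map_smul, Matrix.smul_apply]
  rw [conjMap_apply, mul_mul_conjTranspose_fin_two]
  simp only [conjTranspose_apply, hc]
  simp [dotProduct, mulVec, Fin.sum_univ_two] at hzero ⊢
  right
  linear_combination (c * conj c) * hzero

/-- The shape of a channel that fixes a pure state. -/
theorem IsChannel.exists_form_of_apply_eq_zero {E : OpMap 2} (hE : IsChannel E)
    (h0 : E (single 1 1 1) 0 0 = 0) :
    ∃ (q : ℝ) (a b : ℂ), Complex.normSq a ≤ q ∧ q ≤ 1 ∧
      Complex.normSq b ≤ (q - Complex.normSq a) * (1 - q) ∧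
      ∀ X, E X = !![q * X 0 0, a * X 0 1 + b * X 0 0;
        conj a * X 1 0 + conj b * X 0 0, (1 - q) * X 0 0 + X 1 1] := by
  have hC := hE.1.posSemidef_choi
  have hrow : ∀ j l, E (single 1 j 1) 0 l = 0 := fun j l =>
    PosSemidef.apply_eq_zero (i := (1, 0)) hC h0 (j, l)
  have htr : ∀ i j, E (single i j 1) 0 0 + E (single i j 1) 1 1 = if i = j then 1 else 0 := by
    intro i j
    rw [← trace_fin_two, hE.2]
    split_ifs with h
    · subst h; simp
    · simp [h]
  have hconj := hE.1.map_single_apply_conj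
  have hq : ((E (single 0 0 1) 0 0).re : ℂ) = E (single 0 0 1) 0 0 :=
    Complex.conj_eq_iff_re.1 (hconj 0 0 0 0)
  have e1 : E (single 1 1 1) 1 1 = 1 := by simpa [h0] using htr 1 1
  have e2 : E (single 1 1 1) 1 0 = 0 := by rw [← hconj, hrow, map_zero]
  have e3 : E (single 1 0 1) 1 1 = 0 := by simpa [hrow] using htr 1 0
  have e4 : E (single 0 0 1) 1 1 = 1 - E (single 0 0 1) 0 0 := by
    rw [eq_sub_iff_add_eq']; simpa using htr 0 0
  have e5 : E (single 0 1 1) 0 0 = 0 := by rw [← hconj, hrow, map_zero]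
  have e6 : E (single 0 1 1) 1 0 = 0 := by rw [← hconj, hrow, map_zero]
  have e7 : E (single 0 1 1) 1 1 = 0 := by rw [← hconj, e3, map_zero]
  have e8 := hconj 0 1 0 1
  have e9 := hconj 0 0 0 1
  set q := (E (single 0 0 1) 0 0).re
  set a := E (single 0 1 1) 0 1
  set b := E (single 0 0 1) 0 1
  have m1 := (hC.submatrix ![((0 : Fin 2), (0 : Fin 2)), (1, 1)]).det_nonneg
  have m2 := hC.diag_nonneg (i := (0, 1))
  -- This minor equals `(q - |a|²)(1 - q) - |b|²`.
  have m3 := (hC.submatrix ![((0 : Fin 2), (0 : Fin 2)), (0, 1), (1, 1)]).det_nonneg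
  rw [det_fin_two] at m1
  rw [det_fin_three] at m3
  simp only [submatrix_apply, cons_val_zero, cons_val_one, cons_val, choi_apply, e1, e3, e4,
    e7, ← e8, ← e9, ← hq] at m1 m2 m3
  refine ⟨q, a, b, ?_, ?_, ?_, fun X => ?_⟩
  · have : (q : ℂ) * 1 - a * conj a = ((q - Complex.normSq a : ℝ) : ℂ) := by
      rw [Complex.mul_conj]; push_cast; ring
    rw [this] at m1
    have := Complex.zero_le_real.1 m1
    linarith
  · have := Complex.zero_le_real.1 (show (0 : ℂ) ≤ ((1 - q : ℝ) : ℂ) by push_cast; exact m2)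
    linarith
  · have := Complex.zero_le_real.1 (show (0 : ℂ) ≤
        (((q - Complex.normSq a) * (1 - q) - Complex.normSq b : ℝ) : ℂ) by
      push_cast
      rw [← Complex.mul_conj, ← Complex.mul_conj]
      convert m3 using 1
      ring)
    linarith
  · rw [map_eq_sum_single E X]
    ext i j
    fin_cases i <;> fin_cases j <;>
      simp [e1, e2, e3, e4, e5, e6, e7, ← e8, ← e9, hrow, ← hq] <;> ring

/-- One step of Gaussian elimination on the Choi matrix: `s` clears `b` against the pivot `q -
|a|²`, and the inequality says that the Schur complement stays nonnegative. For a zero pivot `b` is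
already zero. -/
theorem exists_shear_parameter {q : ℝ} {a b : ℂ} (h1 : Complex.normSq a ≤ q) (h2 : q ≤ 1)
    (h3 : Complex.normSq b ≤ (q - Complex.normSq a) * (1 - q)) :
    ∃ s : ℂ, s * (q - Complex.normSq a : ℝ) = -conj b ∧
      Complex.normSq s * (q - Complex.normSq a) ≤ 1 - q := by
  rcases h1.eq_or_lt with h | h
  · refine ⟨0, ?_, by simpa using h2⟩
    rw [← h, sub_self, zero_mul] at h3
    rw [Complex.normSq_eq_zero.1 (le_antisymm h3 (Complex.normSq_nonneg b))]
    simp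
  · have h' := sub_pos.2 h
    refine ⟨-conj b / (q - Complex.normSq a : ℝ),
      div_mul_cancel₀ _ (Complex.ofReal_ne_zero.2 h'.ne'), ?_⟩
    rw [Complex.normSq_div, Complex.normSq_neg, Complex.normSq_conj, Complex.normSq_ofReal,
      div_mul_eq_mul_div, mul_div_mul_right _ _ h'.ne', div_le_iff₀ h']
    linarith

theorem exists_norm_one_mul_eq_norm (a : ℂ) : ∃ u : ℂ, u * conj u = 1 ∧ u * a = (‖a‖ : ℝ) := by
  by_cases ha : a = 0
  · exact ⟨1, by simp [ha]⟩
  have hn : ((‖a‖ : ℝ) : ℂ) ≠ 0 := Complex.ofReal_ne_zero.2 (norm_ne_zero_iff.2 ha)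
  have h : a * conj a = ((‖a‖ : ℝ) : ℂ) ^ 2 := Complex.mul_conj' a
  refine ⟨conj a / (‖a‖ : ℝ), ?_, ?_⟩
  · simp only [map_div₀, Complex.conj_conj, Complex.conj_ofReal]
    field_simp
    linear_combination h
  · field_simp
    linear_combination h

theorem not_isDiag_normalForm {v x z : ℝ} (hz : z ≠ 0) :
    ¬ (pauliMatrix (normalForm v x z)).IsDiag := by
  intro h
  rw [normalForm, pauliMatrix_ofPauliMatrix] at h
  have := h (i := 0) (j := 3) (by decide)
  simp [normalFormMatrix] at this
  exact hz this

/-- Diagonal scalings of the input leave `z` free, so one value suffices. The choice `z = 1/2` is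
nonzero, hence non-diagonal, and below `1`, hence reached by an invertible scaling. -/
theorem IsChannel.exists_normalForm {E : OpMap 2} (hE : IsChannel E)
    (h0 : E (single 1 1 1) 0 0 = 0) :
    ∃ M, LocallyEquivalent E M ∧ ¬ (pauliMatrix M).IsDiag ∧
      ∃ v x z : ℝ, Admissible v x z ∧ M = normalForm v x z := by
  obtain ⟨q, a, b, h1, h2, h3, hX⟩ := hE.exists_form_of_apply_eq_zero h0
  obtain ⟨s, hs, hs'⟩ := exists_shear_parameter h1 h2 h3
  obtain ⟨u, hu, hua⟩ := exists_norm_one_mul_eq_norm a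
  have ha := Complex.normSq_nonneg a
  set r : ℝ := 1 - q - Complex.normSq s * (q - Complex.normSq a) with hr
  have hr0 : 0 ≤ r := by linarith
  have hqr : 0 < q + r := by
    rcases (ha.trans h1).eq_or_lt with h | h
    · have : Complex.normSq a = 0 := by linarith
      rw [hr, this, ← h]; norm_num
    · linarith
  have hqr' : 0 < 3 / (2 * (q + r)) := by positivity
  -- `α² (q + r) = 1 + z` and `β² = 1 - z` with `z = 1/2`; then `α² q = 1 + v` and `α² r = z - v`
  -- determine `v`.
  set α := √(3 / (2 * (q + r)))
  set β := √(1 / 2 : ℝ)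
  have hβ := ofReal_sqrt_mul_self (by norm_num : (0 : ℝ) ≤ 1 / 2)
  have hα0 : α ≠ 0 := (Real.sqrt_pos.2 hqr').ne'
  have hβ0 : β ≠ 0 := (Real.sqrt_pos.2 (by norm_num)).ne'
  have hα2 : α * α = 3 / (2 * (q + r)) := Real.mul_self_sqrt hqr'.le
  have hu0 : u ≠ 0 := left_ne_zero_of_mul_eq_one hu
  set v := α * α * q - 1 with hv
  have hvr : 1 / 2 - v = α * α * r := by
    rw [hv, hα2]; field_simp; ring
  obtain ⟨x, hx⟩ : ∃ x : ℝ, x * f v (1 / 2) = α * β * ‖a‖ := by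
    by_cases hf : f v (1 / 2) = 0
    · refine ⟨0, ?_⟩
      have hq : q = 0 := by
        have h := f_sq (v := v) (z := 1 / 2) (by rw [hv]; nlinarith [mul_self_nonneg α])
          (by norm_num)
        rw [hf, hv] at h
        have : α * α * q = 0 := by linarith
        exact (mul_eq_zero.1 this).resolve_left (mul_ne_zero hα0 hα0)
      have : a = 0 := Complex.normSq_eq_zero.1 (by linarith)
      simp [this]
    · exact ⟨_, div_mul_cancel₀ _ hf⟩
  have hLE : LocallyEquivalent E (normalForm v x (1 / 2)) := by
    -- The output shear by `s` removes `b` but puts `s * a * X 0 1` and its conjugate counterpart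
    -- into the lower right entry; the input shear cancels these. The phase `u` turns `a` into its
    -- norm.
    refine ⟨!![(α : ℂ), 0; -s * a * α, β], !![u, 0; s, 1], ?_, ?_, ?_⟩
    · rw [det_fin_two_of]
      simp [hα0, hβ0]
    · rw [det_fin_two_of]
      simp [hu0]
    · ext1 X
      have ea : (Complex.normSq a : ℂ) = a * conj a := (Complex.mul_conj a).symm
      have es : (Complex.normSq s : ℂ) = s * conj s := (Complex.mul_conj s).symm
      have hvr' := congrArg Complex.ofReal hvr
      have hvc := congrArg Complex.ofReal hv
      have hrc := congrArg Complex.ofReal hr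
      have hsc := congrArg conj hs
      have huac := congrArg conj hua
      simp only [map_mul, map_neg, Complex.conj_conj, Complex.conj_ofReal] at hsc huac
      push_cast at hs hsc hvr' hvc hrc hβ
      rw [ea] at hs hsc hrc
      rw [es] at hrc
      rw [normalForm_apply, hx]
      simp only [LinearMap.comp_apply]
      rw [hX, conjMap_apply, conjMap_apply]
      ext i j
      rw [mul_mul_conjTranspose_fin_two]
      simp only [of_apply, cons_val', cons_val_zero, cons_val_one, cons_val_fin_one,
        mul_mul_conjTranspose_fin_two]
      fin_cases i <;> fin_cases j <;> simp [Complex.conj_ofReal]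
      · linear_combination X 0 0 * hvc - X 0 0 * q * α * α * hu
      · linear_combination (-α * β * X 0 1) * hua - u * α * α * X 0 0 * hsc
      · linear_combination (-α * β * X 1 0) * huac - conj u * α * α * X 0 0 * hs
      · linear_combination X 0 0 * hvr' + X 0 0 * α * α * hrc -
          X 0 0 * α * α * (s * hsc + conj s * hs) - X 1 1 * hβ
  refine ⟨_, hLE, not_isDiag_normalForm (by norm_num), ?_⟩
  obtain ⟨y, hy, h⟩ := (hLE.isCompletelyPositive hE.1).exists_admissible (by norm_num)
  exact ⟨v, y, _, hy, h⟩

/-! ### Channels with invertible outputs: scaling to a unital channel -/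

section MatrixOrder

open scoped MatrixOrder

theorem exists_conjugate_eq_one {P : Op 2} (hP : P.PosSemidef) (hdet : P.det ≠ 0) :
    ∃ B : Op 2, IsUnit B.det ∧ B * P * Bᴴ = 1 := by
  obtain ⟨C, rfl⟩ := CStarAlgebra.nonneg_iff_eq_star_mul_self.mp hP.nonneg
  rw [star_eq_conjTranspose] at hdet ⊢
  rw [det_mul] at hdet
  have h1 : IsUnit Cᴴ.det := isUnit_iff_ne_zero.2 (left_ne_zero_of_mul hdet)
  have h2 : IsUnit C.det := isUnit_iff_ne_zero.2 (right_ne_zero_of_mul hdet)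
  refine ⟨(Cᴴ)⁻¹, isUnit_nonsing_inv_det _ h1, ?_⟩
  rw [← Matrix.mul_assoc, nonsing_inv_mul _ h1, Matrix.one_mul, conjTranspose_nonsing_inv,
    conjTranspose_conjTranspose, mul_nonsing_inv _ h2]

end MatrixOrder

/-- Sum of the squared absolute values of the entries. -/
def entryNormSq (A : Op 2) : ℝ := ∑ i, ∑ j, Complex.normSq (A i j)

theorem normSq_le_entryNormSq (A : Op 2) (i j : Fin 2) :
    Complex.normSq (A i j) ≤ entryNormSq A :=
  (Finset.single_le_sum (f := fun j => Complex.normSq (A i j))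
    (fun _ _ => Complex.normSq_nonneg _) (Finset.mem_univ j)).trans
  (Finset.single_le_sum (f := fun i => ∑ j, Complex.normSq (A i j))
    (fun _ _ => Finset.sum_nonneg fun _ _ => Complex.normSq_nonneg _) (Finset.mem_univ i))

theorem entryNormSq_pos {A : Op 2} (hA : A ≠ 0) : 0 < entryNormSq A := by
  obtain ⟨i, j, hij⟩ : ∃ i j, A i j ≠ 0 := by
    by_contra! h
    exact hA (Matrix.ext h)
  exact (Complex.normSq_pos.2 hij).trans_le (normSq_le_entryNormSq A i j)

theorem entryNormSq_smul (c : ℂ) (A : Op 2) :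
    entryNormSq (c • A) = Complex.normSq c * entryNormSq A := by
  simp [entryNormSq]
  ring

theorem isCompact_of_entry_bound {S : Set (Op 2)} (hS : IsClosed S)
    (h : ∀ A ∈ S, ∀ i j, ‖A i j‖ ≤ 1) : IsCompact S := by
  have : IsCompact (Set.pi Set.univ fun _ : Fin 2 => Set.pi Set.univ fun _ : Fin 2 =>
      Metric.closedBall (0 : ℂ) 1) :=
    isCompact_univ_pi fun _ => isCompact_univ_pi fun _ => isCompact_closedBall 0 1
  refine IsCompact.of_isClosed_subset this hS fun A hA => ?_
  exact fun i _ j _ => mem_closedBall_zero_iff.2 (h A hA i j)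

theorem isCompact_entryNormSq_eq_one : IsCompact {A : Op 2 | entryNormSq A = 1} := by
  refine isCompact_of_entry_bound (isClosed_eq ?_ continuous_const) fun A hA i j => ?_
  · unfold entryNormSq
    have h : ∀ i j, Continuous fun A : Op 2 => Complex.normSq (A i j) := fun i j =>
      Complex.continuous_normSq.comp (continuous_id.matrix_elem i j)
    exact continuous_finsetSum _ fun i _ => continuous_finsetSum _ fun j _ => h i j
  · have := normSq_le_entryNormSq A i j
    rw [show entryNormSq A = 1 from hA, Complex.normSq_eq_norm_sq] at this
    nlinarith [norm_nonneg (A i j)]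

theorem isCompact_unitary : IsCompact {U : Op 2 | Uᴴ * U = 1} := by
  refine isCompact_of_entry_bound (isClosed_eq (by fun_prop) continuous_const) fun U hU i j => ?_
  exact entry_norm_bound_of_unitary (mem_unitaryGroup_iff'.2 hU) i j

theorem continuous_opMap (E : OpMap 2) : Continuous E := E.continuous_of_finiteDimensional

/-- If `E` is positive definite on all `A * Aᴴ`, the ratio of `|det A|²` and `det (E (A * Aᴴ))`
attains its maximum, at an invertible matrix. -/
theorem exists_max_det_ratio {E : OpMap 2} (hE : IsCompletelyPositive E)
    (hdet : ∀ A : Op 2, A ≠ 0 → (E (A * Aᴴ)).det ≠ 0) :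
    ∃ A₀ : Op 2, A₀.det ≠ 0 ∧ ∀ A : Op 2,
      Complex.normSq A.det * (E (A₀ * A₀ᴴ)).det.re ≤
        Complex.normSq A₀.det * (E (A * Aᴴ)).det.re := by
  have hpos : ∀ A : Op 2, A ≠ 0 → 0 < (E (A * Aᴴ)).det.re := fun A hA => by
    have h := (hE.map_posSemidef (posSemidef_self_mul_conjTranspose A)).det_nonneg
    exact (Complex.pos_iff.1 (lt_of_le_of_ne h (hdet A hA).symm)).1
  have hne : ∀ A : Op 2, entryNormSq A = 1 → A ≠ 0 := by
    rintro A hA rfl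
    simp [entryNormSq] at hA
  -- Numerator and denominator have the same degree, so a maximum over the unit sphere is global.
  have hscale : ∀ (t : ℝ) (A : Op 2),
      Complex.normSq ((t : ℂ) • A).det = t ^ 4 * Complex.normSq A.det ∧
      (E (((t : ℂ) • A) * ((t : ℂ) • A)ᴴ)).det.re = t ^ 4 * (E (A * Aᴴ)).det.re := by
    intro t A
    constructor
    · rw [det_smul, Fintype.card_fin, map_mul, map_pow, Complex.normSq_ofReal]
      ring
    · rw [conjTranspose_smul, Matrix.smul_mul, Matrix.mul_smul, smul_smul, map_smul, det_smul,
        Fintype.card_fin, Complex.star_def, Complex.conj_ofReal, ← Complex.ofReal_mul,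
        ← Complex.ofReal_pow, Complex.re_ofReal_mul]
      ring
  have hnormalize : ∀ A : Op 2, A ≠ 0 → ∃ t : ℝ, 0 < t ∧ entryNormSq ((t : ℂ) • A) = 1 := by
    intro A hA
    have h := entryNormSq_pos hA
    refine ⟨(√(entryNormSq A))⁻¹, inv_pos.2 (Real.sqrt_pos.2 h), ?_⟩
    rw [entryNormSq_smul, Complex.normSq_ofReal, ← mul_inv, Real.mul_self_sqrt h.le,
      inv_mul_cancel₀ h.ne']
  obtain ⟨t₁, ht₁, h₁⟩ := hnormalize 1 one_ne_zero
  have hcont : ContinuousOn (fun A : Op 2 => Complex.normSq A.det / (E (A * Aᴴ)).det.re)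
      {A : Op 2 | entryNormSq A = 1} := by
    have hc : Continuous fun A : Op 2 => E (A * Aᴴ) := (continuous_opMap E).comp (by fun_prop)
    refine ContinuousOn.div ?_ ?_ fun A hA => (hpos A (hne A hA)).ne'
    · exact (Complex.continuous_normSq.comp continuous_id.matrix_det).continuousOn
    · exact (Complex.continuous_re.comp hc.matrix_det).continuousOn
  obtain ⟨A₀, hA₀, hmax⟩ := isCompact_entryNormSq_eq_one.exists_isMaxOn ⟨_, h₁⟩ hcont
  have hD₀ := hpos A₀ (hne A₀ hA₀)
  have key : ∀ A : Op 2, A ≠ 0 → Complex.normSq A.det * (E (A₀ * A₀ᴴ)).det.re ≤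
        Complex.normSq A₀.det * (E (A * Aᴴ)).det.re := by
    intro A hA
    obtain ⟨t, ht, hu⟩ := hnormalize A hA
    have h : Complex.normSq ((t : ℂ) • A).det /
        (E (((t : ℂ) • A) * ((t : ℂ) • A)ᴴ)).det.re ≤
        Complex.normSq A₀.det / (E (A₀ * A₀ᴴ)).det.re := hmax hu
    rw [(hscale t A).1, (hscale t A).2, mul_div_mul_left _ _ (by positivity),
      div_le_div_iff₀ (hpos A hA) hD₀] at h
    exact h
  refine ⟨A₀, fun h => ?_, fun A => ?_⟩
  · have := key 1 one_ne_zero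
    rw [h, map_zero, zero_mul, det_one, map_one, one_mul] at this
    exact this.not_gt hD₀
  · by_cases hA : A = 0
    · subst hA
      simp
    · exact key A hA

/-- First-order optimality: for `k` a small positive multiple of `conj y` the linear term would
exceed the quadratic one. -/
theorem eq_zero_of_forall_mul_re_le {y : ℂ} {r : ℝ}
    (h : ∀ k : ℂ, 2 * (k * y).re ≤ Complex.normSq k * r) : y = 0 := by
  by_contra hy
  have hp := Complex.normSq_pos.2 hy
  have hr : 0 < |r| + 1 := by positivity
  have h1 := h (((|r| + 1)⁻¹ : ℝ) * conj y)
  rw [mul_assoc, mul_comm (conj y), Complex.mul_conj, ← Complex.ofReal_mul, Complex.ofReal_re,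
    map_mul, Complex.normSq_ofReal, Complex.normSq_conj] at h1
  have h2 : (|r| + 1)⁻¹ * r ≤ 1 := by
    rw [inv_mul_le_iff₀ hr]
    linarith [le_abs_self r]
  have h3 : 0 < (|r| + 1)⁻¹ * Complex.normSq y := by positivity
  nlinarith

theorem trace_eq_of_trace_pauli {E : OpMap 2} (h1 : E 1 = 1)
    (h : ∀ i : Fin 4, i ≠ 0 → (E (pauli i)).trace = 0) (X : Op 2) :
    (E X).trace = X.trace := by
  have hX : X = ((X 0 0 + X 1 1) / 2) • (1 : Op 2) + ((X 0 1 + X 1 0) / 2) • pauli 1 +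
      (Complex.I * (X 0 1 - X 1 0) / 2) • pauli 2 + ((X 0 0 - X 1 1) / 2) • pauli 3 := by
    ext i j
    fin_cases i <;> fin_cases j <;> simp [pauli] <;> ring_nf <;> simp [Complex.I_sq] <;> ring_nf
  have h2 : (E X).trace = X 0 0 + X 1 1 := by
    rw [hX]
    simp only [map_add, map_smul, trace_add, trace_smul, h 1 (by decide), h 2 (by decide),
      h 3 (by decide), h1, trace_one]
    simp [pauli]
    ring
  rw [h2, trace_fin_two]

/-- Equality holds at `A = 1`. Along `A = 1 + s σᵢ` the difference of the two sides is `2s(1 + s²) τ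
+ O(s²)` with `τ` the real part of the trace of `E σᵢ`, so nonnegativity for both signs of `s`
forces `τ = 0`. The imaginary part vanishes by positivity. -/
theorem IsCompletelyPositive.isChannel_of_det_le {E : OpMap 2} (hE : IsCompletelyPositive E)
    (h1 : E 1 = 1) (hdet : ∀ A : Op 2, Complex.normSq A.det ≤ (E (A * Aᴴ)).det.re) :
    IsChannel E := by
  refine ⟨hE, trace_eq_of_trace_pauli h1 fun i hi => ?_⟩
  have hsq : ∀ s : ℝ, (1 + (s : ℂ) • pauli i) * (1 + (s : ℂ) • pauli i)ᴴ =
      ((1 + s ^ 2 : ℝ) : ℂ) • (1 : Op 2) + ((2 * s : ℝ) : ℂ) • pauli i := by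
    intro s
    ext a b
    fin_cases i
    · exact absurd rfl hi
    all_goals fin_cases a <;> fin_cases b <;>
      simp [pauli, mul_apply, Fin.sum_univ_two] <;> ring_nf <;> simp [Complex.I_sq]
  have hd : ∀ s : ℝ, (1 + (s : ℂ) • pauli i).det = ((1 - s ^ 2 : ℝ) : ℂ) := by
    intro s
    rw [det_fin_two]
    fin_cases i
    · exact absurd rfl hi
    all_goals
      simp [pauli]
      try ring_nf
      try simp [Complex.I_sq]
      try ring_nf
  have hEs : ∀ s : ℝ, E ((1 + (s : ℂ) • pauli i) * (1 + (s : ℂ) • pauli i)ᴴ) =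
      ((1 + s ^ 2 : ℝ) : ℂ) • (1 : Op 2) + ((2 * s : ℝ) : ℂ) • E (pauli i) := by
    intro s
    rw [hsq, map_add, map_smul, map_smul, h1]
  have him : (E (pauli i)).trace.im = 0 := by
    have hp := hE.map_posSemidef (posSemidef_self_mul_conjTranspose
      (1 + ((1 : ℝ) : ℂ) • pauli i))
    have ht := (Complex.nonneg_iff.1 hp.trace_nonneg).2
    rw [hEs, trace_add, trace_smul, trace_smul, trace_one] at ht
    simp at ht
    exact ht
  have hre : (E (pauli i)).trace.re = 0 := by
    have hineq : ∀ s : ℝ, 0 ≤ 2 * s * (1 + s ^ 2) * (E (pauli i)).trace.re +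
        4 * s ^ 2 * ((E (pauli i)).det.re + 1) := by
      intro s
      have h := hdet (1 + (s : ℂ) • pauli i)
      have e : (((1 + s ^ 2 : ℝ) : ℂ) • (1 : Op 2) + ((2 * s : ℝ) : ℂ) • E (pauli i)).det =
          (((1 + s ^ 2) ^ 2 : ℝ) : ℂ) + ((2 * s * (1 + s ^ 2) : ℝ) : ℂ) * (E (pauli i)).trace +
            ((4 * s ^ 2 : ℝ) : ℂ) * (E (pauli i)).det := by
        rw [det_fin_two, det_fin_two, trace_fin_two]
        simp
        ring
      rw [hEs, hd, Complex.normSq_ofReal, e, Complex.add_re, Complex.add_re, Complex.re_ofReal_mul,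
        Complex.re_ofReal_mul, Complex.ofReal_re] at h
      linarith
    generalize (E (pauli i)).trace.re = τ at hineq
    generalize (E (pauli i)).det.re + 1 = e at hineq
    by_contra hτ
    have hτ2 : 0 < τ ^ 2 := by positivity
    have he : 0 < 2 * (|e| + 1) := by positivity
    -- A step against the sign of `τ`, short enough that the quadratic term cannot compensate.
    have h := hineq (-τ * (2 * (|e| + 1))⁻¹)
    set c := (2 * (|e| + 1))⁻¹ with hc
    have hc0 : 0 < c := inv_pos.2 he
    have h2 : 2 * (c * e) < 1 := by
      rw [hc, ← mul_assoc, mul_comm 2, mul_assoc, inv_mul_lt_iff₀ he]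
      linarith [le_abs_self e]
    have h3 : 0 < c * τ ^ 2 := by positivity
    have h4 : 0 ≤ c * τ ^ 2 * (-τ * c) ^ 2 := by positivity
    nlinarith [mul_pos h3 (sub_pos.2 h2)]
  exact Complex.ext hre him

/-- The rescaling moves the maximiser to the identity and the maximal ratio to `1`; maximality of
`A₀`, tested at `A₀ * A`, is then the determinant inequality that yields trace preservation. -/
theorem IsCompletelyPositive.exists_unital_channel {E : OpMap 2} (hE : IsCompletelyPositive E)
    (hdet : ∀ A : Op 2, A ≠ 0 → (E (A * Aᴴ)).det ≠ 0) :
    ∃ F, LocallyEquivalent E F ∧ IsChannel F ∧ F 1 = 1 := by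
  obtain ⟨A₀, hA₀, hmax⟩ := exists_max_det_ratio hE hdet
  have hA₀' : A₀ ≠ 0 := by
    rintro rfl
    simp at hA₀
  obtain ⟨B, hB, hB1⟩ := exists_conjugate_eq_one
    (hE.map_posSemidef (posSemidef_self_mul_conjTranspose A₀)) (hdet A₀ hA₀')
  have hLE : LocallyEquivalent E (conjMap B ∘ₗ E ∘ₗ conjMap A₀) :=
    ⟨A₀, B, isUnit_iff_ne_zero.2 hA₀, hB, rfl⟩
  have hunital : (conjMap B ∘ₗ E ∘ₗ conjMap A₀) 1 = 1 := by
    simpa [conjMap_apply] using hB1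
  refine ⟨_, hLE, (hLE.isCompletelyPositive hE).isChannel_of_det_le hunital fun A => ?_, hunital⟩
  have hdetB : ∀ P : Op 2, (B * P * Bᴴ).det.re = Complex.normSq B.det * P.det.re := by
    intro P
    rw [det_mul, det_mul, det_conjTranspose, mul_right_comm, Complex.star_def, Complex.mul_conj,
      Complex.re_ofReal_mul]
  have hone := congrArg (fun P : Op 2 => P.det.re) hB1
  simp only [hdetB, det_one, Complex.one_re] at hone
  have h := hmax (A₀ * A)
  rw [det_mul, map_mul, mul_assoc, mul_le_mul_iff_right₀ (Complex.normSq_pos.2 hA₀)] at h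
  have e : (conjMap B ∘ₗ E ∘ₗ conjMap A₀) (A * Aᴴ) = B * E ((A₀ * A) * (A₀ * A)ᴴ) * Bᴴ := by
    simp [conjMap_apply, conjTranspose_mul, Matrix.mul_assoc]
  rw [e, hdetB]
  calc Complex.normSq A.det
      = Complex.normSq B.det * (Complex.normSq A.det * (E (A₀ * A₀ᴴ)).det.re) := by
        rw [mul_left_comm, hone, mul_one]
    _ ≤ _ := mul_le_mul_of_nonneg_left h (Complex.normSq_nonneg _)

/-! ### Diagonalising a unital channel by unitaries -/

/-- The unitary with entries proportional to `1, k, -conj k, 1`. -/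
theorem exists_unitary_proportional (k : ℂ) :
    ∃ c : ℝ, c * c * (1 + Complex.normSq k) = 1 ∧
      ∀ U : Op 2, U = !![(c : ℂ), c * k; -(c * conj k), c] → Uᴴ * U = 1 ∧ Uᴴᴴ * Uᴴ = 1 := by
  have hk := Complex.normSq_nonneg k
  have hpos : 0 < 1 + Complex.normSq k := by linarith
  have hc : (√(1 + Complex.normSq k))⁻¹ * (√(1 + Complex.normSq k))⁻¹ *
      (1 + Complex.normSq k) = 1 := by
    rw [← mul_inv, Real.mul_self_sqrt hpos.le, inv_mul_cancel₀ hpos.ne']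
  refine ⟨_, hc, ?_⟩
  rintro _ rfl
  set c := (√(1 + Complex.normSq k))⁻¹
  have hc' := congrArg Complex.ofReal hc
  push_cast at hc'
  rw [← Complex.mul_conj] at hc'
  have : (!![(c : ℂ), c * k; -(c * conj k), c] : Op 2)ᴴ *
      !![(c : ℂ), c * k; -(c * conj k), c] = 1 := by
    ext i j
    fin_cases i <;> fin_cases j <;>
      simp [mul_apply, Fin.sum_univ_two, Complex.conj_ofReal]
    · linear_combination hc'
    · ring
    · ring
    · linear_combination hc'
  exact ⟨this, by rw [conjTranspose_conjTranspose]; exact mul_eq_one_comm.1 this⟩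

/-- By unitaries, the overlap of the image of the pure state `single 0 0 1` with that state can be
made maximal. -/
theorem IsChannel.exists_unitary_max {E : OpMap 2} (hE : IsChannel E) (h1 : E 1 = 1) :
    ∃ F, LocallyEquivalent E F ∧ IsChannel F ∧ F 1 = 1 ∧
      ∀ U V : Op 2, Uᴴ * U = 1 → Vᴴ * V = 1 →
        ((U * F (V * single 0 0 1 * Vᴴ) * Uᴴ) 0 0).re ≤ (F (single 0 0 1) 0 0).re := by
  have hcont : Continuous fun p : Op 2 × Op 2 =>
      ((conjMap p.1 (E (conjMap p.2 (single 0 0 1)))) 0 0).re := by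
    have h2 : Continuous fun p : Op 2 × Op 2 => E (conjMap p.2 (single 0 0 1)) := by
      refine (continuous_opMap E).comp ?_
      simp only [conjMap_apply]
      fun_prop
    have h3 : Continuous fun p : Op 2 × Op 2 =>
        p.1 * E (conjMap p.2 (single 0 0 1)) * p.1ᴴ :=
      (continuous_fst.matrix_mul h2).matrix_mul continuous_fst.matrix_conjTranspose
    exact Complex.continuous_re.comp (h3.matrix_elem 0 0)
  obtain ⟨⟨U, V⟩, ⟨hU, hV⟩, hmax⟩ := (isCompact_unitary.prod isCompact_unitary).exists_isMaxOn
    ⟨((1 : Op 2), (1 : Op 2)), by simp⟩ hcont.continuousOn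
  change Uᴴ * U = 1 at hU
  change Vᴴ * V = 1 at hV
  obtain ⟨hLE, hF⟩ := hE.unitary_comp hU hV
  refine ⟨_, hLE, hF, ?_, fun U' V' hU' hV' => ?_⟩
  · simp only [LinearMap.comp_apply, conjMap_apply, Matrix.mul_one]
    rw [mul_eq_one_comm.1 hV, h1, Matrix.mul_one, mul_eq_one_comm.1 hU]
  · have hu : (U' * U)ᴴ * (U' * U) = 1 := by
      rw [conjTranspose_mul, Matrix.mul_assoc, ← Matrix.mul_assoc U'ᴴ, hU', Matrix.one_mul, hU]
    have hv : (V * V')ᴴ * (V * V') = 1 := by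
      rw [conjTranspose_mul, Matrix.mul_assoc, ← Matrix.mul_assoc Vᴴ, hV, Matrix.one_mul, hV']
    have h := isMaxOn_iff.1 hmax (U' * U, V * V') ⟨hu, hv⟩
    dsimp only at h
    rw [← conjMap_comp, ← conjMap_comp, LinearMap.comp_apply, LinearMap.comp_apply] at h
    simp only [LinearMap.comp_apply]
    rw [← conjMap_apply, ← conjMap_apply V']
    exact h

/-- At the maximal overlap, the variation by an output unitary gives the first vanishing entry and
the variation by an input unitary the second. -/
theorem IsChannel.exists_unitary_diagonal {E : OpMap 2} (hE : IsChannel E) (h1 : E 1 = 1) :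
    ∃ F, LocallyEquivalent E F ∧ IsChannel F ∧ F 1 = 1 ∧
      F (single 0 0 1) 1 0 = 0 ∧ F (single 1 0 1) 0 0 = 0 := by
  obtain ⟨F, hLE, hF, hF1, hmax⟩ := hE.exists_unitary_max h1
  refine ⟨F, hLE, hF, hF1, ?_, ?_⟩
  · refine eq_zero_of_forall_mul_re_le
      (r := (F (single 0 0 1) 0 0).re - (F (single 0 0 1) 1 1).re) fun k => ?_
    obtain ⟨c, hc, hW⟩ := exists_unitary_proportional k
    have h := hmax _ 1 (hW _ rfl).1 (by simp)
    rw [Matrix.one_mul, conjTranspose_one, Matrix.mul_one, mul_mul_conjTranspose_fin_two] at h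
    have e := hF.1.map_single_apply_conj 0 0 1 0
    have e' : (F (single 0 0 1) 0 1).re = (F (single 0 0 1) 1 0).re ∧
        (F (single 0 0 1) 0 1).im = -(F (single 0 0 1) 1 0).im := by
      rw [← e]; simp
    simp [e'.1, e'.2] at h
    rw [Complex.normSq_apply] at hc ⊢
    rw [Complex.mul_re]
    have hN : 0 ≤ 1 + (k.re * k.re + k.im * k.im) :=
      add_nonneg zero_le_one (add_nonneg (mul_self_nonneg _) (mul_self_nonneg _))
    have h' := mul_le_mul_of_nonneg_left h hN
    linear_combination h' - ((F (single 0 0 1) 0 0).re +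
      2 * (k.re * (F (single 0 0 1) 1 0).re - k.im * (F (single 0 0 1) 1 0).im) +
      (k.re * k.re + k.im * k.im) * (F (single 0 0 1) 1 1).re) * hc
  · refine eq_zero_of_forall_mul_re_le
      (r := (F (single 0 0 1) 0 0).re - (F (single 1 1 1) 0 0).re) fun k => ?_
    -- With `conj k`, the first column of the adjoint is `c * (1, k)`, so `k` multiplies `F (single
    -- 1 0 1)`.
    obtain ⟨c, hc, hW⟩ := exists_unitary_proportional (conj k)
    have h := hmax 1 _ (by simp) (hW _ rfl).2
    rw [Matrix.one_mul, conjTranspose_one, Matrix.mul_one, map_eq_sum_single F] at h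
    simp only [mul_mul_conjTranspose_fin_two, Matrix.add_apply, Matrix.smul_apply] at h
    have e := hF.1.map_single_apply_conj 1 0 0 0
    have e' : (F (single 0 1 1) 0 0).re = (F (single 1 0 1) 0 0).re ∧
        (F (single 0 1 1) 0 0).im = -(F (single 1 0 1) 0 0).im := by
      rw [← e]; simp
    simp [e'.1, e'.2] at h
    rw [Complex.normSq_conj, Complex.normSq_apply] at hc
    rw [Complex.normSq_apply, Complex.mul_re]
    have hN : 0 ≤ 1 + (k.re * k.re + k.im * k.im) :=
      add_nonneg zero_le_one (add_nonneg (mul_self_nonneg _) (mul_self_nonneg _))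
    have h' := mul_le_mul_of_nonneg_left h hN
    linear_combination h' - ((F (single 0 0 1) 0 0).re +
      2 * (k.re * (F (single 1 0 1) 0 0).re - k.im * (F (single 1 0 1) 0 0).im) +
      (k.re * k.re + k.im * k.im) * (F (single 1 1 1) 0 0).re) * hc

/-- If `w` and `y` are the phases correcting `a` and `b`, the conditions `α β = w` and `α conj β =
y` amount to `α² = w y` and `β = w conj α`. -/
theorem exists_phases (a b : ℂ) : ∃ α β : ℂ, α * conj α = 1 ∧ β * conj β = 1 ∧
    α * β * a = (‖a‖ : ℝ) ∧ α * conj β * b = (‖b‖ : ℝ) := by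
  obtain ⟨w, hw, hwa⟩ := exists_norm_one_mul_eq_norm a
  obtain ⟨y, hy, hyb⟩ := exists_norm_one_mul_eq_norm b
  obtain ⟨α, hα⟩ := IsAlgClosed.exists_pow_nat_eq (w * y) (n := 2) (by norm_num)
  have hα1 : α * conj α = 1 := by
    have h : (α * conj α) ^ 2 = 1 := by
      rw [mul_pow, ← map_pow, hα, map_mul]
      linear_combination y * conj y * hw + hy
    rw [Complex.mul_conj] at h ⊢
    norm_cast at h ⊢
    exact (pow_eq_one_iff_of_nonneg (Complex.normSq_nonneg α) two_ne_zero).1 h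
  refine ⟨α, w * conj α, hα1, ?_, ?_, ?_⟩
  · simp only [map_mul, Complex.conj_conj]
    linear_combination α * conj α * hw + hα1
  · linear_combination hwa + w * a * hα1
  · simp only [map_mul, Complex.conj_conj]
    linear_combination hyb + conj w * b * hα + y * b * hw

/-- Unitality, trace preservation and the two zeros decouple diagonal from off-diagonal entries. On
the latter the map mixes `X 0 1` and `X 1 0` with two complex coefficients; diagonal unitaries make
both real, and then `σ₁` and `σ₂` are eigenvectors. -/
theorem IsChannel.exists_isPauliChannel {E : OpMap 2} (hE : IsChannel E) (h1 : E 1 = 1)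
    (h00 : E (single 0 0 1) 1 0 = 0) (h10 : E (single 1 0 1) 0 0 = 0) :
    ∃ M, LocallyEquivalent E M ∧ IsPauliChannel M := by
  have hconj := hE.1.map_single_apply_conj
  have htr : ∀ i j, E (single i j 1) 0 0 + E (single i j 1) 1 1 = if i = j then 1 else 0 := by
    intro i j
    rw [← trace_fin_two, hE.2]
    split_ifs with h
    · subst h; simp
    · simp [h]
  have hsum : E (single 0 0 1) + E (single 1 1 1) = 1 := by
    rw [← map_add, ← h1]
    congr 1
    ext i j
    fin_cases i <;> fin_cases j <;> simp
  have e1 : E (single 0 0 1) 0 1 = 0 := by rw [← hconj, h00, map_zero]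
  have e2 : E (single 0 1 1) 0 0 = 0 := by rw [← hconj, h10, map_zero]
  have e3 : E (single 1 0 1) 1 1 = 0 := by simpa [h10] using htr 1 0
  have e4 : E (single 0 1 1) 1 1 = 0 := by simpa [e2] using htr 0 1
  have e5 : E (single 1 1 1) 0 1 = 0 := by simpa [e1] using congr_fun₂ hsum 0 1
  have e6 : E (single 1 1 1) 1 0 = 0 := by simpa [h00] using congr_fun₂ hsum 1 0
  have e7 : E (single 1 1 1) 0 0 = 1 - E (single 0 0 1) 0 0 :=
    eq_sub_of_add_eq' (by simpa using congr_fun₂ hsum 0 0)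
  have e8 : E (single 0 0 1) 1 1 = 1 - E (single 0 0 1) 0 0 :=
    eq_sub_of_add_eq' (by simpa using htr 0 0)
  have e9 : E (single 1 1 1) 1 1 = E (single 0 0 1) 0 0 := by
    have := htr 1 1
    rw [e7, if_pos rfl] at this
    linear_combination this
  have ea := hconj 0 1 0 1
  have eb := hconj 0 1 1 0
  obtain ⟨α, β, hα, hβ, ha, hb⟩ := exists_phases (E (single 0 1 1) 0 1) (E (single 0 1 1) 1 0)
  have hD : ∀ γ : ℂ, γ * conj γ = 1 → (!![γ, 0; 0, 1] : Op 2)ᴴ * !![γ, 0; 0, 1] = 1 := by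
    intro γ hγ
    rw [mul_comm] at hγ
    ext i j
    fin_cases i <;> fin_cases j <;> simp [mul_apply, Fin.sum_univ_two, hγ]
  obtain ⟨hLE, hM⟩ := hE.unitary_comp (hD β hβ) (hD α hα)
  refine ⟨_, hLE, hM, ?_⟩
  have hac := congrArg conj ha
  have hbc := congrArg conj hb
  simp only [map_mul, Complex.conj_conj, Complex.conj_ofReal] at hac hbc
  have hMX : ∀ X, (conjMap !![β, 0; 0, 1] ∘ₗ E ∘ₗ conjMap !![α, 0; 0, 1]) X =
      !![E (single 0 0 1) 0 0 * X 0 0 + (1 - E (single 0 0 1) 0 0) * X 1 1,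
        (‖E (single 0 1 1) 0 1‖ : ℝ) * X 0 1 + (‖E (single 0 1 1) 1 0‖ : ℝ) * X 1 0;
        (‖E (single 0 1 1) 0 1‖ : ℝ) * X 1 0 + (‖E (single 0 1 1) 1 0‖ : ℝ) * X 0 1,
        (1 - E (single 0 0 1) 0 0) * X 0 0 + E (single 0 0 1) 0 0 * X 1 1] := by
    intro X
    simp only [LinearMap.comp_apply]
    rw [conjMap_apply, map_eq_sum_single E]
    ext i j
    rw [mul_mul_conjTranspose_fin_two]
    simp only [conjMap_apply, mul_mul_conjTranspose_fin_two, Matrix.add_apply, Matrix.smul_apply,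
      smul_eq_mul, e1, e2, e3, e4, e5, e6, e7, e8, e9, h00, h10, ← ea, ← eb]
    fin_cases i <;> fin_cases j <;> simp
    · linear_combination (α * conj α * X 0 0 * E (single 0 0 1) 0 0 +
        X 1 1 * (1 - E (single 0 0 1) 0 0)) * hβ + X 0 0 * E (single 0 0 1) 0 0 * hα
    · linear_combination X 0 1 * ha + X 1 0 * hbc
    · linear_combination X 1 0 * hac + X 0 1 * hb
    · linear_combination X 0 0 * (1 - E (single 0 0 1) 0 0) * hα
  intro i j hij
  simp only [pauliMatrix, of_apply, hMX]
  fin_cases i <;> fin_cases j <;> first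
    | exact absurd rfl hij
    | (simp [pauli, trace_fin_two] <;> ring_nf)

/-- Every qubit channel is locally equivalent to a Pauli channel or to one of the non-diagonal
normal forms. -/
theorem IsChannel.exists_locallyEquivalent_normalForm {E : OpMap 2} (hE : IsChannel E) :
    ∃ M, LocallyEquivalent E M ∧ (IsPauliChannel M ∨
      (¬ (pauliMatrix M).IsDiag ∧ ∃ v x z : ℝ, Admissible v x z ∧ M = normalForm v x z)) := by
  by_cases h : ∀ A : Op 2, A ≠ 0 → (E (A * Aᴴ)).det ≠ 0
  · obtain ⟨F, hEF, hF, hF1⟩ := hE.1.exists_unital_channel h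
    obtain ⟨G, hFG, hG, hG1, h00, h10⟩ := hF.exists_unitary_diagonal hF1
    obtain ⟨M, hGM, hM⟩ := hG.exists_isPauliChannel hG1 h00 h10
    exact ⟨M, (hEF.trans hFG).trans hGM, Or.inl hM⟩
  · push Not at h
    obtain ⟨A, hA, hdet⟩ := h
    obtain ⟨F, hEF, hF, hF0⟩ := hE.exists_locallyEquivalent_apply_eq_zero hA hdet
    obtain ⟨M, hFM, hM⟩ := hF.exists_normalForm hF0
    exact ⟨M, hEF.trans hFM, Or.inr hM⟩

end QubitLorentz

end

theorem theorem3 :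
    -- every qubit channel has a normal form
    (∀ E : QubitLorentz.OpMap 2, QubitLorentz.IsChannel E →
      ∃ T₁ T₂ M : QubitLorentz.OpMap 2,
        QubitLorentz.HasKrausRank T₁ 1 ∧ QubitLorentz.HasKrausRank T₂ 1 ∧
        E = T₂ ∘ₗ M ∘ₗ T₁ ∧
        (QubitLorentz.IsPauliChannel M ∨
          (¬ (QubitLorentz.pauliMatrix M).IsDiag ∧
            ∃ v x z : ℝ, QubitLorentz.Admissible v x z ∧
              M = QubitLorentz.normalForm v x z))) ∧
    -- for `0 ≤ z` the four cases exhaust the completely positive normal forms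
    (∀ v x z : ℝ, 0 ≤ z →
      (QubitLorentz.IsCompletelyPositive (QubitLorentz.normalForm v x z) ↔
        ∃ y : ℝ, QubitLorentz.Admissible v y z ∧
          QubitLorentz.normalForm v x z = QubitLorentz.normalForm v y z)) ∧
    -- Kraus ranks in the four cases
    (∀ v x z : ℝ, QubitLorentz.CaseI v x z →
      (v < z → QubitLorentz.HasKrausRank (QubitLorentz.normalForm v x z) 3) ∧
      (v = z → QubitLorentz.HasKrausRank (QubitLorentz.normalForm v x z) 2)) ∧
    (∀ v x z : ℝ, QubitLorentz.CaseII v x z →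
      (v < z → QubitLorentz.HasKrausRank (QubitLorentz.normalForm v x z) 2) ∧
      (v = z → QubitLorentz.HasKrausRank (QubitLorentz.normalForm v x z) 1)) ∧
    -- third case, with the range of `z` extended from `[0,1)` to `[-1,1)`
    (∀ z : ℝ, z ∈ Set.Ico (-1 : ℝ) 1 →
      (-1 < z → QubitLorentz.HasKrausRank (QubitLorentz.normalForm (-1) 0 z) 2) ∧
      (z = -1 → QubitLorentz.HasKrausRank (QubitLorentz.normalForm (-1) 0 z) 1)) ∧
    (∀ v x z : ℝ, QubitLorentz.CaseIV v x z →
      (|v| < 1 → QubitLorentz.HasKrausRank (QubitLorentz.normalForm v x z) 2) ∧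
      (|v| = 1 → QubitLorentz.HasKrausRank (QubitLorentz.normalForm v x z) 1)) ∧
    -- general bounds
    (∀ v x z : ℝ, QubitLorentz.IsCompletelyPositive (QubitLorentz.normalForm v x z) →
      ∃ n ≤ 3, QubitLorentz.HasKrausRank (QubitLorentz.normalForm v x z) n) ∧
    (∀ v z : ℝ, QubitLorentz.IsCompletelyPositive (QubitLorentz.normalForm v 1 z) →
      ∃ n ≤ 2, QubitLorentz.HasKrausRank (QubitLorentz.normalForm v 1 z) n) := by
  refine ⟨fun E hE => ?_, fun v x z hz => ⟨fun h => h.exists_admissible hz, ?_⟩,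
    fun v x z h => h.krausRank, fun v x z h => h.krausRank,
    fun z hz => QubitLorentz.krausRank_normalForm_neg_one hz, fun v x z h => h.krausRank,
    fun v x z h => h.hasKrausRepresentation_three.exists_hasKrausRank_le, fun v z h => ?_⟩
  · obtain ⟨M, hEM, hM⟩ := hE.exists_locallyEquivalent_normalForm
    obtain ⟨T₁, T₂, h₁, h₂, hE'⟩ := hEM.exists_eq_comp
    exact ⟨T₁, T₂, M, h₁, h₂, hE', hM⟩
  · rintro ⟨y, hy, h⟩
    rw [h]
    exact hy.isCompletelyPositive
  · obtain ⟨h0, h1, h2, -⟩ := h.normalForm_bounds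
    exact (QubitLorentz.hasKrausRepresentation_two h0 h1 h2 (one_pow 2)).exists_hasKrausRank_le
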